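/- **Setting.** Let $F:\mathbb R^n\to\mathbb R^n$ be real analytic and suppose that for every $x\in\mathbb R^n$ the solution $t\mapsto S^t(x)$ of $\dot x=F(x)$ with $S^0(x)=x$ exists for all $t\ge 0$. Let $x^*$ be an (asymptotically) stable equilibrium with basin of attraction $\mathbb B=\{x: S^t(x)\to x^*\text{ as }t\to\infty\}$. Assume that the Jacobian matrix of $F$ at $x^*$ has $n$ distinct eigenvalues $\lambda_1,\dots,\lambda_n$ with $\operatorname{Re}\lambda_j<0$ that are non-resonant: $m_1\lambda_1+\dots+m_n\lambda_n=0$ with $m\in\mathbb Z^n$ forces $m=0$. Let $\phi_1,\dots,\phi_n:\mathbb B\to\mathbb C$ be Koopman principal eigenfunctions: each $\phi_j$ is smooth, not identically zero, and $\phi_j(S^t(x))=e^{\lambda_j t}\phi_j(x)$ for all $x\in\mathbb B$, $t\ge0$. For $\alpha\in\mathbb N_0^n$ put $|\alpha|=\sum_i\alpha_i$, $\alpha\cdot\lambda=\sum_i\alpha_i\lambda_i$, $z^\alpha=\prod_i z_i^{\alpha_i}$ and $\phi_\alpha=\prod_i\phi_i^{\alpha_i}$. Assume that the state components belong to the modulated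 Segal–Bargmann space of $h=(\phi_1,\dots,\phi_n)$: for each $k$ there is an entire function $g_k:\mathbb C^n\to\mathbb C$ with $\int_{\mathbb C^n}|g_k(z)|^2e^{-|z|^2}\,dz<\infty$ and $x_k=g_k(h(x))$ for all $x\in\mathbb B$. Fix such $g_k$. With $\langle f_1,f_2\rangle=\pi^{-n}\int_{\mathbb C^n} f_1\overline{f_2}\,e^{-|z|^2}dz$, the Koopman modes are $$V_{\alpha k}=\frac{\langle g_k,z^\alpha\rangle}{\langle z^\alpha,z^\alpha\rangle},\qquad V_{jk}=V_{e_j k}.$$ Define the participation factors and generalized participations $$P_j^k=\frac{\partial\phi_j}{\partial x_k}V_{jk},\quad P_j^{k(\ell)}=\frac{\partial\phi_j}{\partial x_\ell}V_{jk},\quad P_{i(j)}^k=\frac{\partial\phi_j}{\partial x_k}V_{ik},$$ $$P_\alpha^k=\frac{\partial\phi_\alpha}{\partial x_k}V_{\alpha k},\quad P_\alpha^{k(\ell)}=\frac{\partial\phi_\alpha}{\partial x_\ell}V_{\alpha k},\quad P_{\alpha(j)}^k=\frac{\partial\phi_j}{\partial x_k}V_{\alpha k}.$$ **Theorem.** Let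 $x^0\in\mathbb B$. Then $x^0+\delta x\in\mathbb B$ for all sufficiently small $\delta x\in\mathbb R^n$, and the following hold for all $t\ge0$ and all $j,k\in\{1,\dots,n\}$, as $\delta x\to0$ with $t$ and $x^0$ fixed. (1) The variation of the state, $dx_k=S^t(x^0+\delta x)_k-S^t(x^0)_k$, satisfies $$dx_k=\sum_{j}e^{\lambda_jt}P_j^k(x^0)\,\delta x_k+\sum_{\ell\ne k}\sum_{j}e^{\lambda_jt}P_j^{k(\ell)}(x^0)\,\delta x_\ell+\sum_{|\alpha|>1}e^{(\alpha\cdot\lambda)t}P_\alpha^k(x^0)\,\delta x_k+\sum_{\ell\ne k}\sum_{|\alpha|>1}e^{(\alpha\cdot\lambda)t}P_\alpha^{k(\ell)}(x^0)\,\delta x_\ell+O(\|\delta x\|^2),$$ where all the series over $\alpha$ converge absolutely. (2) The variation of the modal variable $z_j=\phi_j(x)$, $dz_j=\phi_j(S^t(x^0+\delta x))-\phi_j(S^t(x^0))$, satisfies $$dz_j=e^{\lambda_jt}\sum_kP_j^k(x^0)\,\delta z_j^0+e^{\lambda_jt}\sum_{i\ne j}\sum_kP_{i(j)}^k(x^0)\,\delta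 z_i^0+e^{\lambda_jt}\sum_{|\alpha|>1}\sum_kP_{\alpha(j)}^k(x^0)\,\delta z_\alpha^0+O(\|\delta x\|^2),$$ where $\delta z_i^0=\phi_i(x^0+\delta x)-\phi_i(x^0)$ and $\delta z_\alpha^0=\phi_\alpha(x^0+\delta x)-\phi_\alpha(x^0)$. For each $k$ the series $\sum_{|\alpha|>1}P_{\alpha(j)}^k(x^0)\,\delta z_\alpha^0$ converges absolutely whenever $x^0+\delta x\in\mathbb B$. -/

import Mathlib

open Set Filter Topology MeasureTheory Asymptotics
open scoped ContDiff

noncomputable section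

namespace KoopmanPF

/-- The state space, `n`-dimensional Euclidean space. -/
abbrev State (n : ℕ) : Type := EuclideanSpace ℝ (Fin n)

variable {n : ℕ}

/-- `S` is the semiflow of `ẋ = F x`: for every `x`, the curve `t ↦ S t x` on `[0, ∞)` is a
solution that starts at `x`. Nothing is said about `S t` for negative `t`. -/
structure IsSemiflow (F : State n → State n) (S : ℝ → State n → State n) : Prop where
  initial : ∀ x, S 0 x = x
  solution : ∀ x, ∀ t, 0 ≤ t → HasDerivWithinAt (fun s => S s x) (F (S t x)) (Ici 0) t

/-- The basin of attraction of `xs`. -/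
def basin (S : ℝ → State n → State n) (xs : State n) : Set (State n) :=
  {x | Tendsto (fun t => S t x) atTop (𝓝 xs)}

/-- `xs` is an (asymptotically) stable equilibrium point: an equilibrium, Lyapunov stable, and
attracting all nearby states. -/
structure IsStableEquilibrium (F : State n → State n) (S : ℝ → State n → State n)
    (xs : State n) : Prop where
  equilibrium : F xs = 0
  lyapunov : ∀ ε > 0, ∃ δ > 0, ∀ x, ‖x - xs‖ < δ → ∀ t, 0 ≤ t → ‖S t x - xs‖ < ε
  attracting : ∀ᶠ x in 𝓝 xs, x ∈ basin S xs

/-- The partial derivative `∂f/∂x_k` at `x`. -/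
def partialDeriv {E : Type*} [NormedAddCommGroup E] [NormedSpace ℝ E]
    (k : Fin n) (f : State n → E) (x : State n) : E :=
  fderiv ℝ f x (EuclideanSpace.single k 1)

/-- The Jacobian matrix of `F` at `x`, as a complex matrix. -/
def jacobian (F : State n → State n) (x : State n) : Matrix (Fin n) (Fin n) ℂ :=
  Matrix.of fun i k => ((partialDeriv k F x i : ℝ) : ℂ)

/-- The linearization of `F` at `xs` has the `n` distinct, non-resonant eigenvalues
`lam 0, …, lam (n - 1)`, all with strictly negative real part. -/
structure HasSpectrum (F : State n → State n) (xs : State n) (lam : Fin n → ℂ) : Prop where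
  distinct : Function.Injective lam
  eigenvalue : ∀ j, Module.End.HasEigenvalue (Matrix.toLin' (jacobian F xs)) (lam j)
  nonresonant : ∀ m : Fin n → ℤ, ∑ j, (m j : ℂ) * lam j = 0 → m = 0
  negative : ∀ j, (lam j).re < 0

/-- `φ` is a Koopman eigenfunction with eigenvalue `μ` on the set `B`: a smooth function on `B`,
not identically zero there, with `φ ∘ S t = exp (μ t) φ` on `B` for all `t ≥ 0`. -/
structure IsKoopmanEigenfunction (S : ℝ → State n → State n) (B : Set (State n)) (μ : ℂ)
    (φ : State n → ℂ) : Prop where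
  smooth : ContDiffOn ℝ ∞ φ B
  nonzero : ∃ x ∈ B, φ x ≠ 0
  eigen : ∀ x ∈ B, ∀ t : ℝ, 0 ≤ t → φ (S t x) = Complex.exp (μ * t) * φ x

/-- The product `φ_1 ^ α_1 ⋯ φ_n ^ α_n` of powers of the principal eigenfunctions. -/
def eigenMonomial (φ : Fin n → State n → ℂ) (α : Fin n → ℕ) (x : State n) : ℂ :=
  ∏ i, φ i x ^ α i

/-- The eigenvalue `α_1 λ_1 + ⋯ + α_n λ_n`. -/
def eigenvalueComb (lam : Fin n → ℂ) (α : Fin n → ℕ) : ℂ :=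
  ∑ i, (α i : ℂ) * lam i

/-- The multi-indices of order greater than one, which index the higher-order terms. -/
abbrev HigherIndex (n : ℕ) : Type := {α : Fin n → ℕ // 1 < ∑ i, α i}

/-- The Gaussian weight `exp (-|z|²)` on `ℂⁿ`, with `|z|² = |z_1|² + ⋯ + |z_n|²`. -/
def gaussWeight (z : Fin n → ℂ) : ℝ :=
  Real.exp (-∑ i, ‖z i‖ ^ 2)

/-- The Segal–Bargmann inner product `π⁻ⁿ ∫ g₁ (conj g₂) exp (-|z|²) dz` over `ℂⁿ`. -/
def segalBargmannInner (g₁ g₂ : (Fin n → ℂ) → ℂ) : ℂ :=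
  ((Real.pi : ℂ) ^ n)⁻¹ *
    ∫ z : Fin n → ℂ, g₁ z * (starRingEnd ℂ) (g₂ z) * (gaussWeight z : ℂ)

/-- The Segal–Bargmann space: entire functions on `ℂⁿ` with finite norm. -/
structure MemSegalBargmann (g : (Fin n → ℂ) → ℂ) : Prop where
  entire : Differentiable ℂ g
  finiteNorm : Integrable fun z : Fin n → ℂ => ‖g z‖ ^ 2 * gaussWeight z

/-- The observable `f` on `B` is the element `g ∘ h` of the modulated Segal–Bargmann space, where
`h = (φ_1, …, φ_n)` and `g` lies in the Segal–Bargmann space. -/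
structure IsModulatedRep (B : Set (State n)) (φ : Fin n → State n → ℂ)
    (f : State n → ℂ) (g : (Fin n → ℂ) → ℂ) : Prop where
  mem : MemSegalBargmann g
  eq_comp : ∀ x ∈ B, f x = g fun i => φ i x

/-- The monomial `z_1 ^ α_1 ⋯ z_n ^ α_n`; composed with `(φ_1, …, φ_n)` it is
`eigenMonomial φ α`. -/
def monomialFun (α : Fin n → ℕ) (z : Fin n → ℂ) : ℂ :=
  ∏ i, z i ^ α i

/-- The Koopman mode `V_{αk}`: the coefficient of the state component `x_k`, represented by
`g k`, along the eigenfunction `eigenMonomial φ α` with respect to the inner product of the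
modulated Segal–Bargmann space. -/
def koopmanMode (g : Fin n → (Fin n → ℂ) → ℂ) (α : Fin n → ℕ) (k : Fin n) : ℂ :=
  segalBargmannInner (g k) (monomialFun α) /
    segalBargmannInner (monomialFun α) (monomialFun α)

/-- The Koopman mode `V_{jk}` of the `j`-th principal eigenfunction. -/
def principalMode (g : Fin n → (Fin n → ℂ) → ℂ) (j k : Fin n) : ℂ :=
  koopmanMode g (Pi.single j 1) k

/-- Participation factor `P_j^k(x) = ∂φ_j/∂x_k(x) V_{jk}`. -/
def pf (φ : Fin n → State n → ℂ) (g : Fin n → (Fin n → ℂ) → ℂ)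
    (j k : Fin n) (x : State n) : ℂ :=
  partialDeriv k (φ j) x * principalMode g j k

/-- Mode-in-state generalized participation `P_j^{k(ℓ)}(x) = ∂φ_j/∂x_ℓ(x) V_{jk}`. -/
def gpModeInState (φ : Fin n → State n → ℂ) (g : Fin n → (Fin n → ℂ) → ℂ)
    (j k l : Fin n) (x : State n) : ℂ :=
  partialDeriv l (φ j) x * principalMode g j k

/-- State-in-mode generalized participation `P_{i(j)}^k(x) = ∂φ_j/∂x_k(x) V_{ik}`. -/
def gpStateInMode (φ : Fin n → State n → ℂ) (g : Fin n → (Fin n → ℂ) → ℂ)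
    (i j k : Fin n) (x : State n) : ℂ :=
  partialDeriv k (φ j) x * principalMode g i k

/-- Higher-order participation factor `P_α^k(x) = ∂φ^α/∂x_k(x) V_{αk}`. -/
def pfHigh (φ : Fin n → State n → ℂ) (g : Fin n → (Fin n → ℂ) → ℂ)
    (α : Fin n → ℕ) (k : Fin n) (x : State n) : ℂ :=
  partialDeriv k (eigenMonomial φ α) x * koopmanMode g α k

/-- Higher-order mode-in-state generalized participation
`P_α^{k(ℓ)}(x) = ∂φ^α/∂x_ℓ(x) V_{αk}`. -/
def gpModeInStateHigh (φ : Fin n → State n → ℂ) (g : Fin n → (Fin n → ℂ) → ℂ)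
    (α : Fin n → ℕ) (k l : Fin n) (x : State n) : ℂ :=
  partialDeriv l (eigenMonomial φ α) x * koopmanMode g α k

/-- Higher-order state-in-mode generalized participation
`P_{α(j)}^k(x) = ∂φ_j/∂x_k(x) V_{αk}`. -/
def gpStateInModeHigh (φ : Fin n → State n → ℂ) (g : Fin n → (Fin n → ℂ) → ℂ)
    (α : Fin n → ℕ) (j k : Fin n) (x : State n) : ℂ :=
  partialDeriv k (φ j) x * koopmanMode g α k

/-- The variation `dx_k(t; x⁰, δ)` of the `k`-th state component. -/
def stateVariation (S : ℝ → State n → State n) (k : Fin n) (t : ℝ) (x₀ δ : State n) : ℝ :=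
  S t (x₀ + δ) k - S t x₀ k

/-- The variation `dz_j(t; x⁰, δ)` of the modal variable `z_j = φ_j(x)`. -/
def modalVariation (S : ℝ → State n → State n) (φ : Fin n → State n → ℂ) (j : Fin n)
    (t : ℝ) (x₀ δ : State n) : ℂ :=
  φ j (S t (x₀ + δ)) - φ j (S t x₀)

/-- The initial change `δz_j⁰ = φ_j(x⁰ + δ) - φ_j(x⁰)` of the `j`-th mode. -/
def initialChange (φ : Fin n → State n → ℂ) (j : Fin n) (x₀ δ : State n) : ℂ :=
  φ j (x₀ + δ) - φ j x₀

/-- The initial change `δz_α⁰ = φ^α(x⁰ + δ) - φ^α(x⁰)` of a higher-order mode. -/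
def initialChangeHigh (φ : Fin n → State n → ℂ) (α : Fin n → ℕ) (x₀ δ : State n) : ℂ :=
  eigenMonomial φ α (x₀ + δ) - eigenMonomial φ α x₀

/-- The participation-factor expansion of the variation of the `k`-th state component. -/
def stateExpansion (lam : Fin n → ℂ) (φ : Fin n → State n → ℂ)
    (g : Fin n → (Fin n → ℂ) → ℂ) (k : Fin n) (t : ℝ) (x₀ δ : State n) : ℂ :=
  (∑ j, Complex.exp (lam j * t) * pf φ g j k x₀ * (δ k : ℂ))
  + (∑ l ∈ Finset.univ.erase k,
      ∑ j, Complex.exp (lam j * t) * gpModeInState φ g j k l x₀ * (δ l : ℂ))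
  + (∑' α : HigherIndex n,
      Complex.exp (eigenvalueComb lam α * t) * pfHigh φ g α k x₀ * (δ k : ℂ))
  + (∑ l ∈ Finset.univ.erase k, ∑' α : HigherIndex n,
      Complex.exp (eigenvalueComb lam α * t) * gpModeInStateHigh φ g α k l x₀ * (δ l : ℂ))

/-- The participation-factor expansion of the variation of the `j`-th modal variable. -/
def modalExpansion (lam : Fin n → ℂ) (φ : Fin n → State n → ℂ)
    (g : Fin n → (Fin n → ℂ) → ℂ) (j : Fin n) (t : ℝ) (x₀ δ : State n) : ℂ :=
  Complex.exp (lam j * t) * ((∑ k, pf φ g j k x₀) * initialChange φ j x₀ δ)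
  + Complex.exp (lam j * t) * (∑ i ∈ Finset.univ.erase j,
      ∑ k, gpStateInMode φ g i j k x₀ * initialChange φ i x₀ δ)
  + Complex.exp (lam j * t) * (∑' α : HigherIndex n,
      ∑ k, gpStateInModeHigh φ g α j k x₀ * initialChangeHigh φ α x₀ δ)

end KoopmanPF

end

/-! On the basin, `x_k = g_k ∘ h` and `h (S t x)` has the components `exp (λ_i t) φ_i x`. So the
`k`-th component of `S t x` is an entire function composed with the smooth map `modalFlow`. The
state expansion is the differential of this composite at `x⁰`, with the Taylor series of `g_k`
differentiated term by term; the error is a first-order Taylor remainder.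

The modal expansion is `exp (λ_j t) dφ_j(x⁰) δ` in disguise. Subtracting the expansions `x_k = ∑
V_αk φ_α` at `x⁰ + δ` and `x⁰` gives `δ_k = ∑ V_αk δz_α⁰` exactly, and only the Taylor remainder of
`φ_j` is left.

Both arguments need `V_αk` to be the Taylor coefficient of `g_k` (`koopmanMode_eq_torusCoeff`).
Rotating the coordinates preserves the Gaussian measure; averaging the inner product over rotations
replaces `g_k` by its Fourier coefficient on the torus through `z`, which is the Taylor coefficient
times `z^α`. Convergence of the Taylor series (`hasSum_torusCoeff`) comes from Cauchy's formula on a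
polydisc. Openness of the basin (`IsSemiflow.isOpen_basin`) makes small perturbations admissible and
the `φ_j` smooth near `x⁰`. -/

noncomputable section

namespace KoopmanPF

/-! ### Dependence on initial values and openness of the basin -/

section Flow

variable {E : Type*} [NormedAddCommGroup E] [NormedSpace ℝ E] [ProperSpace E]

/-- Solutions of a `C¹` autonomous equation on `[0, T]` depend on their initial values in a
Lipschitz way, near a given solution. -/
theorem exists_dist_le_of_solutions {F : E → E} (hF : ContDiff ℝ 1 F) {u : ℝ → E} {T : ℝ}
    (hu : ∀ t, 0 ≤ t → HasDerivWithinAt u (F (u t)) (Ici 0) t) :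
    ∃ K : ℝ, ∀ v : ℝ → E, (∀ t, 0 ≤ t → HasDerivWithinAt v (F (v t)) (Ici 0) t) →
      dist (u 0) (v 0) * Real.exp K < 1 →
      ∀ t ∈ Icc 0 T, dist (u t) (v t) ≤ dist (u 0) (v 0) * Real.exp K := by
  have cont : ∀ w : ℝ → E, (∀ t, 0 ≤ t → HasDerivWithinAt w (F (w t)) (Ici 0) t) →
      ContinuousOn w (Ici 0) := fun w hw t ht => (hw t ht).continuousWithinAt
  have huc := cont u hu
  have hdist : ∀ w, ContinuousOn w (Ici 0) → ContinuousOn (fun t => dist (u t) (w t)) (Ici 0) :=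
    fun w hw => continuous_dist.comp_continuousOn (huc.prodMk hw)
  obtain ⟨R, hR⟩ : ∃ R, ∀ t ∈ Icc 0 T, ‖u t‖ ≤ R :=
    isCompact_Icc.exists_bound_of_continuousOn (huc.mono Icc_subset_Ici_self)
  -- The margin 1 in the radius matches the hypothesis on `v`: a curve within distance 1 of `u`
  -- stays in this ball, where `F` is Lipschitz.
  obtain ⟨K, hK⟩ := hF.contDiffOn.exists_lipschitzOnWith one_ne_zero
    (convex_closedBall (0 : E) (R + 1)) (isCompact_closedBall (0 : E) (R + 1))
  refine ⟨K * T, fun v hv hd => ?_⟩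
  have hvc := cont v hv
  set d := dist (u 0) (v 0)
  have hmono : ∀ t ∈ Icc 0 T, d * Real.exp (K * t) ≤ d * Real.exp (K * T) := fun t ht => by
    have := ht.2
    gcongr
  suffices H : Icc 0 T ⊆ {t | dist (u t) (v t) ≤ d * Real.exp (K * t)} from
    fun t ht => (H ht).trans (hmono t ht)
  -- Continuous induction: if the estimate holds at `t`, the distance is below 1 there and shortly
  -- afterwards, so both curves lie in the ball and Grönwall, restarted at `t`, extends the
  -- estimate.
  refine IsClosed.Icc_subset_of_forall_mem_nhdsWithin ?_ ?_ ?_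
  · rw [inter_comm]
    have h2 : ContinuousOn (fun t => dist (u t) (v t) - d * Real.exp (K * t)) (Icc 0 T) :=
      ((hdist v hvc).mono Icc_subset_Ici_self).sub (by fun_prop)
    have h3 := h2.preimage_isClosed_of_isClosed isClosed_Icc (isClosed_Iic (a := (0 : ℝ)))
    convert h3 using 2
    ext t
    simp
  · simp [d]
  · rintro t ⟨ht, ht0, htT⟩
    have hlt : dist (u t) (v t) < 1 := (le_trans ht (hmono t ⟨ht0, htT.le⟩)).trans_lt hd
    have hev : ∀ᶠ s in 𝓝[≥] t, dist (u s) (v s) < 1 := by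
      have h2 : ContinuousWithinAt (fun s => dist (u s) (v s)) (Ici t) t :=
        ((hdist v hvc) t ht0).mono (Ici_subset_Ici.2 ht0)
      exact h2.eventually (gt_mem_nhds hlt)
    obtain ⟨b, htb, hb⟩ := (mem_nhdsGE_iff_exists_Icc_subset).1
      (Filter.inter_mem hev (Icc_mem_nhdsGE htT))
    have hmem : ∀ s ∈ Icc t b, u s ∈ Metric.closedBall (0 : E) (R + 1) ∧
        v s ∈ Metric.closedBall (0 : E) (R + 1) := fun s hs => by
      obtain ⟨h1, h2⟩ := hb hs
      have h3 := hR s ⟨ht0.trans hs.1, h2.2⟩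
      have h1 : dist (u s) (v s) < 1 := h1
      rw [mem_closedBall_zero_iff, mem_closedBall_zero_iff]
      refine ⟨by linarith, ?_⟩
      have : ‖v s‖ ≤ ‖u s‖ + ‖u s - v s‖ := by
        simpa using norm_sub_le (u s) (u s - v s)
      rw [dist_eq_norm] at h1
      linarith
    have hsub : Icc t b ⊆ Ici 0 := fun s hs => ht0.trans hs.1
    have key := dist_le_of_trajectories_ODE_of_mem (v := fun _ => F)
      (s := fun _ => Metric.closedBall (0 : E) (R + 1)) (a := t) (b := b) (K := K)
      (f := u) (g := v) (δ := d * Real.exp (K * t)) (fun _ _ => hK) (huc.mono hsub)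
      (fun s hs => (hu s (ht0.trans hs.1)).mono (Ici_subset_Ici.2 (ht0.trans hs.1)))
      (fun s hs => (hmem s (Ico_subset_Icc_self hs)).1) (hvc.mono hsub)
      (fun s hs => (hv s (ht0.trans hs.1)).mono (Ici_subset_Ici.2 (ht0.trans hs.1)))
      (fun s hs => (hmem s (Ico_subset_Icc_self hs)).2) ht
    filter_upwards [Icc_mem_nhdsGT htb] with s hs
    have := key s hs
    rwa [mul_assoc, ← Real.exp_add, ← mul_add, add_sub_cancel] at this

end Flow

variable {n : ℕ} {F : State n → State n} {S : ℝ → State n → State n} {xs : State n}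

/-- Uniqueness of solutions: both sides solve the equation in `t` from the same point, so the
Lipschitz estimate bounds their distance by 0. -/
theorem IsSemiflow.add_apply (hF : ContDiff ℝ 1 F) (hS : IsSemiflow F S) {s t : ℝ} (hs : 0 ≤ s)
    (ht : 0 ≤ t) (x : State n) : S t (S s x) = S (s + t) x := by
  obtain ⟨K, hK⟩ := exists_dist_le_of_solutions hF (T := t) (hS.solution (S s x))
  have h := hK (fun r => S (s + r) x) (fun r hr => ?_) ?_ t ⟨ht, le_rfl⟩
  · simpa [hS.initial] using h
  · have h1 := hS.solution x (s + r) (add_nonneg hs hr)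
    have h2 : HasDerivWithinAt (fun r : ℝ => s + r) 1 (Ici 0) r :=
      ((hasDerivAt_id r).const_add s).hasDerivWithinAt
    simpa [Function.comp_def] using h1.scomp r h2 (fun q hq => add_nonneg hs hq)
  · simp [hS.initial]

theorem IsSemiflow.continuous (hF : ContDiff ℝ 1 F) (hS : IsSemiflow F S) {t : ℝ} (ht : 0 ≤ t) :
    Continuous (S t) := by
  refine continuous_iff_continuousAt.2 fun x => ?_
  obtain ⟨K, hK⟩ := exists_dist_le_of_solutions hF (T := t) (hS.solution x)
  have h0 : Tendsto (fun y => dist x y * Real.exp K) (𝓝 x) (𝓝 0) := by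
    have : Continuous fun y => dist x y * Real.exp K := by fun_prop
    simpa using this.tendsto x
  refine tendsto_iff_dist_tendsto_zero.2 (squeeze_zero' (Eventually.of_forall fun _ =>
    dist_nonneg) ?_ h0)
  filter_upwards [h0.eventually (gt_mem_nhds one_pos)] with y hy
  have := hK (fun r => S r y) (hS.solution y) (by simpa [hS.initial] using hy) t ⟨ht, le_rfl⟩
  simpa [hS.initial, dist_comm] using this

theorem IsSemiflow.apply_mem_basin_iff (hF : ContDiff ℝ 1 F) (hS : IsSemiflow F S) {t : ℝ}
    (ht : 0 ≤ t) {x : State n} : S t x ∈ basin S xs ↔ x ∈ basin S xs := by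
  have h : (fun r => S r (S t x)) =ᶠ[atTop] fun r => S (r + t) x := by
    filter_upwards [eventually_ge_atTop 0] with r hr
    rw [hS.add_apply hF ht hr, add_comm]
  change Tendsto _ _ _ ↔ Tendsto _ _ _
  rw [tendsto_congr' h]
  conv_rhs => rw [← map_add_atTop_eq t, tendsto_map'_iff]
  rfl

/-- A trajectory in the basin reaches, at some time `T`, a point all of whose neighbours are
attracted; the continuous map `S T` pulls that neighbourhood back. -/
theorem IsSemiflow.isOpen_basin (hF : ContDiff ℝ 1 F) (hS : IsSemiflow F S)
    (hxs : IsStableEquilibrium F S xs) : IsOpen (basin S xs) := by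
  refine isOpen_iff_mem_nhds.2 fun x hx => ?_
  have hx' : Tendsto (fun t => S t x) atTop (𝓝 xs) := hx
  obtain ⟨T, hT, hT0⟩ := ((hx'.eventually (eventually_eventually_nhds.2 hxs.attracting)).and
    (eventually_ge_atTop 0)).exists
  filter_upwards [(hS.continuous hF hT0).continuousAt.eventually hT] with y hy
  exact (hS.apply_mem_basin_iff hF hT0).1 hy

end KoopmanPF

/-! ### Cauchy's formula and Fourier characters on the torus -/

namespace KoopmanPF

/-- The point of the unit circle in `ℂ` with angle `θ ∈ ℝ / ℤ`. -/
def unitPoint (θ : UnitAddCircle) : ℂ := AddCircle.toCircle θ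

@[simp] theorem norm_unitPoint (θ : UnitAddCircle) : ‖unitPoint θ‖ = 1 := Circle.norm_coe _

theorem unitPoint_ne_zero (θ : UnitAddCircle) : unitPoint θ ≠ 0 := Circle.coe_ne_zero _

@[fun_prop] theorem continuous_unitPoint : Continuous unitPoint :=
  continuous_subtype_val.comp AddCircle.continuous_toCircle

/-- The normalized Haar measure of the torus `(ℝ / ℤ)ⁿ`. -/
def torusMeasure (n : ℕ) : Measure (Fin n → UnitAddCircle) :=
  Measure.pi fun _ => AddCircle.haarAddCircle

instance (n : ℕ) : IsProbabilityMeasure (torusMeasure n) := by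
  unfold torusMeasure; infer_instance

theorem integrable_torusMeasure {n : ℕ} {f : (Fin n → UnitAddCircle) → ℂ} (hf : Continuous f) :
    Integrable f (torusMeasure n) :=
  hf.integrable_of_hasCompactSupport (HasCompactSupport.of_compactSpace f)

theorem integral_haarAddCircle_unitPoint (f : ℂ → ℂ) (R : ℝ) :
    ∫ θ, f (R * unitPoint θ) ∂AddCircle.haarAddCircle = Real.circleAverage f 0 R := by
  rw [AddCircle.integral_haarAddCircle, ← AddCircle.intervalIntegral_preimage 1 0,
    Real.circleAverage]
  have h := intervalIntegral.integral_comp_mul_left (a := 0) (b := 1) (c := 2 * Real.pi)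
    (fun θ => f (circleMap 0 R θ)) (by positivity)
  simp only [mul_zero, mul_one] at h
  rw [← h]
  simp [unitPoint, AddCircle.toCircle_apply_mk, circleMap]

theorem integral_cauchyKernel_mul {f : ℂ → ℂ} (hf : Differentiable ℂ f) {R : ℝ} {w : ℂ}
    (hw : ‖w‖ < R) :
    ∫ θ, R * unitPoint θ / (R * unitPoint θ - w) * f (R * unitPoint θ)
      ∂AddCircle.haarAddCircle = f w := by
  have hR : 0 < R := (norm_nonneg w).trans_lt hw
  have h := DiffContOnCl.circleAverage_smul_div (c := 0) (R := R) (w := w)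
    hf.diffContOnCl (by simpa [abs_of_pos hR] using hw)
  rw [← h, ← integral_haarAddCircle_unitPoint]
  simp

theorem mul_unitPoint_sub_ne_zero {R : ℝ} {w : ℂ} (hw : ‖w‖ < R) (θ : UnitAddCircle) :
    R * unitPoint θ - w ≠ 0 := by
  have hR : 0 < R := (norm_nonneg w).trans_lt hw
  intro h
  rw [sub_eq_zero] at h
  rw [← h] at hw
  simp [abs_of_pos hR] at hw

/-- Cauchy's integral formula on a polydisc. -/
theorem integral_torus_cauchyKernel_mul : ∀ {n : ℕ} {g : (Fin n → ℂ) → ℂ}, Differentiable ℂ g →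
    ∀ {R : ℝ} {z : Fin n → ℂ}, (∀ i, ‖z i‖ < R) →
    ∫ θ, (∏ i, R * unitPoint (θ i) / (R * unitPoint (θ i) - z i)) *
      g (fun i => R * unitPoint (θ i)) ∂torusMeasure n = g z
  | 0, g, hg, R, z, hz => by
    simp [Subsingleton.elim _ z]
  | n + 1, g, hg, R, z, hz => by
    have e := (measurePreserving_piFinSuccAbove
      (fun _ : Fin (n + 1) => (AddCircle.haarAddCircle : Measure UnitAddCircle)) 0).symm
    set G : (Fin (n + 1) → UnitAddCircle) → ℂ := fun θ =>
      (∏ i, R * unitPoint (θ i) / (R * unitPoint (θ i) - z i)) *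
      g (fun i => R * unitPoint (θ i)) with hG
    have hGc : Continuous G := by
      have := hg.continuous
      refine Continuous.mul (continuous_finsetProd _ fun i _ => ?_) (by fun_prop)
      exact Continuous.div (by fun_prop) (by fun_prop) fun θ => mul_unitPoint_sub_ne_zero (hz i) _
    have hGi := integrable_torusMeasure hGc
    rw [torusMeasure] at hGi ⊢
    rw [← e.map_eq, integral_map_equiv, integral_prod]
    -- With the first coordinate fixed on its circle, the induction hypothesis evaluates the others;
    -- the outer integral is then the one-variable formula.
    · have inner : ∀ t : UnitAddCircle,
          ∫ θ, G ((MeasurableEquiv.piFinSuccAbove (fun _ => UnitAddCircle) 0).symm (t, θ))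
            ∂(Measure.pi fun _ : Fin n => AddCircle.haarAddCircle) =
          R * unitPoint t / (R * unitPoint t - z 0) *
            g (Fin.cons (R * unitPoint t) (fun i => z i.succ)) := by
        intro t
        have ih := integral_torus_cauchyKernel_mul
          (g := fun y : Fin n → ℂ => g (Fin.cons (R * unitPoint t) y)) (R := R)
          (z := fun i => z i.succ) ?_ fun i => hz i.succ
        · rw [← ih, torusMeasure, ← integral_const_mul]
          refine integral_congr_ae (.of_forall fun θ => ?_)
          have : (fun i => (R : ℂ) * unitPoint ((Fin.cons t θ : Fin (n + 1) → UnitAddCircle) i)) =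
              Fin.cons (R * unitPoint t) (fun i => R * unitPoint (θ i)) := by
            ext i; refine Fin.cases ?_ (fun i => ?_) i <;> simp
          simp only [hG, MeasurableEquiv.piFinSuccAbove_symm_apply, Fin.insertNthEquiv_apply,
            Fin.insertNth_zero',
            this, Fin.prod_univ_succ, Fin.cons_zero, Fin.cons_succ, mul_assoc]
        · refine hg.comp ?_
          refine differentiable_pi.2 fun i => ?_
          exact Fin.cases (by simp) (fun i => by simp; fun_prop) i
      refine (integral_congr_ae (.of_forall inner)).trans ?_
      have h1 := integral_cauchyKernel_mul (f := fun w => g (Fin.cons w (fun i => z i.succ))) ?_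
        (hz 0)
      · rw [h1]
        congr 1
        exact Fin.cons_self_tail z
      · refine hg.comp ?_
        refine differentiable_pi.2 fun i => ?_
        refine Fin.cases ?_ (fun i => ?_) i <;> simp
    · exact (e.integrable_comp_emb (MeasurableEquiv.measurableEmbedding _)).2 hGi

/-- The product of finitely many absolutely convergent series is the series over multi-indices. -/
theorem hasSum_prod_of_summable_norm : ∀ {n : ℕ} {f : Fin n → ℕ → ℂ},
    (∀ i, Summable fun m => ‖f i m‖) →
    (Summable fun α : Fin n → ℕ => ‖∏ i, f i (α i)‖) ∧
    HasSum (fun α : Fin n → ℕ => ∏ i, f i (α i)) (∏ i, ∑' m, f i m)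
  | 0, f, hf => by
    refine ⟨(hasSum_fintype _).summable, ?_⟩
    simp
  | n + 1, f, hf => by
    obtain ⟨h1, h2⟩ := hasSum_prod_of_summable_norm (f := fun i : Fin n => f i.succ)
      fun i => hf i.succ
    have hs := (hf 0).mul_norm h1
    have key : ∀ p : ℕ × (Fin n → ℕ), f 0 p.1 * ∏ i : Fin n, f i.succ (p.2 i) =
        ∏ i, f i ((Fin.consEquiv fun _ => ℕ) p i) := fun p => by
      simp [Fin.prod_univ_succ, Fin.consEquiv]
    constructor
    · rw [← (Fin.consEquiv fun _ : Fin (n + 1) => ℕ).summable_iff]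
      exact hs.congr fun p => by rw [key]; rfl
    · rw [← (Fin.consEquiv fun _ : Fin (n + 1) => ℕ).hasSum_iff, Fin.prod_univ_succ]
      refine ((hf 0).of_norm.hasSum.mul h2 hs.of_norm).congr_fun ?_
      intro p
      rw [key]; rfl

theorem hasSum_integral_torus {ι : Type*} [Countable ι] {n : ℕ}
    {f : ι → (Fin n → UnitAddCircle) → ℂ} {u : ι → ℝ} (hf : ∀ i, Continuous (f i))
    (hu : Summable u) (hfu : ∀ i θ, ‖f i θ‖ ≤ u i) {s : (Fin n → UnitAddCircle) → ℂ}
    (hs : ∀ θ, HasSum (fun i => f i θ) (s θ)) :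
    HasSum (fun i => ∫ θ, f i θ ∂torusMeasure n) (∫ θ, s θ ∂torusMeasure n) :=
  hasSum_integral_of_dominated_convergence (fun i _ => u i)
    (fun i => (hf i).aestronglyMeasurable) (fun i => .of_forall (hfu i)) (.of_forall fun _ => hu)
    (integrable_const _) (.of_forall hs)

theorem norm_monomialFun {n : ℕ} (α : Fin n → ℕ) (z : Fin n → ℂ) :
    ‖monomialFun α z‖ = ∏ i, ‖z i‖ ^ α i := by
  simp [monomialFun]

theorem monomialFun_mul {n : ℕ} (α : Fin n → ℕ) (z w : Fin n → ℂ) :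
    monomialFun α (fun i => z i * w i) = monomialFun α z * monomialFun α w := by
  simp [monomialFun, mul_pow, Finset.prod_mul_distrib]

@[fun_prop] theorem differentiable_monomialFun {n : ℕ} (α : Fin n → ℕ) :
    Differentiable ℂ (monomialFun α) := by
  unfold monomialFun
  fun_prop

@[fun_prop] theorem continuous_monomialFun {n : ℕ} (α : Fin n → ℕ) :
    Continuous (monomialFun α) := (differentiable_monomialFun α).continuous

/-- The character of the torus with nonnegative frequencies `α`. -/
def torusChar {n : ℕ} (α : Fin n → ℕ) (θ : Fin n → UnitAddCircle) : ℂ :=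
  monomialFun α fun i => unitPoint (θ i)

@[fun_prop] theorem continuous_torusChar {n : ℕ} (α : Fin n → ℕ) : Continuous (torusChar α) := by
  unfold torusChar
  fun_prop

@[simp] theorem norm_torusChar {n : ℕ} (α : Fin n → ℕ) (θ : Fin n → UnitAddCircle) :
    ‖torusChar α θ‖ = 1 := by
  simp [torusChar, norm_monomialFun]

theorem integral_conj_torusChar_mul {n : ℕ} (α β : Fin n → ℕ) :
    ∫ θ, (starRingEnd ℂ) (torusChar α θ) * torusChar β θ ∂torusMeasure n =
      if β = α then 1 else 0 := by
  have h1 : ∀ a b : ℕ, ∫ t, (starRingEnd ℂ) (unitPoint t ^ a) * unitPoint t ^ b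
      ∂AddCircle.haarAddCircle = if b = a then 1 else 0 := fun a b => by
    have := congrFun (fourierCoeff_fourier (T := 1) b) a
    rw [fourierCoeff] at this
    simp only [Pi.single_apply, Nat.cast_inj, fourier_neg] at this
    simp only [eq_comm (a := b)]
    rw [← this]
    simp [unitPoint, AddCircle.toCircle_nsmul]
  have h2 : ∀ θ : Fin n → UnitAddCircle, (starRingEnd ℂ) (torusChar α θ) * torusChar β θ =
      ∏ i, (starRingEnd ℂ) (unitPoint (θ i) ^ α i) * unitPoint (θ i) ^ β i := fun θ => by
    simp [torusChar, monomialFun, Finset.prod_mul_distrib]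
  simp only [h2, torusMeasure]
  rw [integral_fintype_prod_eq_prod (fun i t => (starRingEnd ℂ) (unitPoint t ^ α i) *
    unitPoint t ^ β i)]
  simp only [h1]
  split_ifs with h
  · simp [h]
  · obtain ⟨i, hi⟩ := Function.ne_iff.1 h
    exact Finset.prod_eq_zero (Finset.mem_univ i) (if_neg hi)

/-- The Fourier coefficient of `g` on the torus through `z`. -/
def torusCoeff {n : ℕ} (g : (Fin n → ℂ) → ℂ) (z : Fin n → ℂ) (α : Fin n → ℕ) : ℂ :=
  ∫ θ, (starRingEnd ℂ) (torusChar α θ) * g (fun i => z i * unitPoint (θ i)) ∂torusMeasure n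

/-! ### Taylor series of entire functions of several variables -/

section Expansion

variable {n : ℕ} {g : (Fin n → ℂ) → ℂ} {R : ℝ} {z : Fin n → ℂ}

theorem summable_norm_monomialFun_div (hz : ∀ i, ‖z i‖ < R) :
    Summable fun α : Fin n → ℕ => ‖monomialFun α fun i => z i / R‖ := by
  refine (hasSum_prod_of_summable_norm (f := fun i m => (z i / R) ^ m) fun i => ?_).1
  have hR := (norm_nonneg _).trans_lt (hz i)
  simp only [norm_pow]
  refine summable_geometric_of_lt_one (norm_nonneg _) ?_
  rw [norm_div, Complex.norm_real, Real.norm_of_nonneg hR.le, div_lt_one hR]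
  exact hz i

/-- Each factor of the Cauchy kernel is a geometric series in `z i / (R * unitPoint (θ i))`. Since
`g` is bounded on the torus, the product series can be integrated term by term. -/
theorem hasSum_torusCoeff_mul (hg : Differentiable ℂ g) (hz : ∀ i, ‖z i‖ < R) :
    HasSum (fun α => torusCoeff g (fun _ => R) α * monomialFun α fun i => z i / R) (g z) := by
  have hgc := hg.continuous
  have hc : Continuous fun θ : Fin n → UnitAddCircle => g fun i => R * unitPoint (θ i) := by
    fun_prop
  obtain ⟨C, hC⟩ := isCompact_univ.exists_bound_of_continuousOn hc.continuousOn
  rw [← integral_torus_cauchyKernel_mul hg hz]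
  have := hasSum_integral_torus (n := n)
    (f := fun (α : Fin n → ℕ) θ => ((starRingEnd ℂ) (torusChar α θ) *
      g (fun i => R * unitPoint (θ i))) * monomialFun α fun i => z i / R)
    (u := fun α => C * ‖monomialFun α fun i => z i / R‖)
    (s := fun θ => (∏ i, R * unitPoint (θ i) / (R * unitPoint (θ i) - z i)) *
      g (fun i => R * unitPoint (θ i))) ?_ ?_ ?_ ?_
  · simpa only [integral_mul_const, torusCoeff] using this
  · intro α
    exact ((Complex.continuous_conj.comp (continuous_torusChar α)).mul hc).mul continuous_const
  · exact (summable_norm_monomialFun_div hz).mul_left C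
  · intro α θ
    rw [norm_mul, norm_mul, RCLike.norm_conj, norm_torusChar, one_mul]
    exact mul_le_mul_of_nonneg_right (hC θ (mem_univ _)) (norm_nonneg _)
  · intro θ
    have hr : ∀ i, ‖z i / (R * unitPoint (θ i))‖ < 1 := fun i => by
      have hR := (norm_nonneg _).trans_lt (hz i)
      rw [norm_div, norm_mul, norm_unitPoint, mul_one, Complex.norm_real,
        Real.norm_of_nonneg hR.le, div_lt_one hR]
      exact hz i
    have h := (hasSum_prod_of_summable_norm (f := fun i m => (z i / (R * unitPoint (θ i))) ^ m)
      fun i => by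
        simpa only [norm_pow] using summable_geometric_of_lt_one (norm_nonneg _) (hr i)).2
    have h2 : ∏ i, ∑' m, (z i / (R * unitPoint (θ i))) ^ m =
        ∏ i, R * unitPoint (θ i) / (R * unitPoint (θ i) - z i) := by
      refine Finset.prod_congr rfl fun i _ => ?_
      rw [tsum_geometric_of_norm_lt_one (hr i)]
      have hR := (norm_nonneg _).trans_lt (hz i)
      have h3 := mul_unitPoint_sub_ne_zero (hz i) (θ i)
      have h4 := unitPoint_ne_zero (θ i)
      have h5 : (R : ℂ) ≠ 0 := by exact_mod_cast hR.ne'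
      rw [one_sub_div (mul_ne_zero h5 h4), inv_div]
    rw [← h2]
    refine (h.mul_right _).congr_fun fun α => ?_
    -- On the unit circle inversion is conjugation, so the powers of the kernel become conjugate
    -- characters.
    have h6 : ∀ i, z i / (R * unitPoint (θ i)) =
        (starRingEnd ℂ) (unitPoint (θ i)) * (z i / R) := fun i => by
      have : (starRingEnd ℂ) (unitPoint (θ i)) = (unitPoint (θ i))⁻¹ := by
        rw [Complex.inv_def, Complex.normSq_eq_norm_sq]; simp
      rw [this]; field_simp
    simp only [h6, torusChar, monomialFun, mul_pow, Finset.prod_mul_distrib, map_prod, map_pow]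
    ring

/-- Insert the expansion of `g` at the rotated point and integrate against the conjugate character:
orthogonality leaves only the term `α`. The coordinates of `z` may vanish or differ in modulus. -/
theorem torusCoeff_eq (hg : Differentiable ℂ g) (hz : ∀ i, ‖z i‖ < R) (α : Fin n → ℕ) :
    torusCoeff g z α = torusCoeff g (fun _ => R) α * monomialFun α fun i => z i / R := by
  have hz' : ∀ (θ : Fin n → UnitAddCircle) i, ‖z i * unitPoint (θ i)‖ < R := fun θ i => by
    simpa using hz i
  have hmon : ∀ (β : Fin n → ℕ) (θ : Fin n → UnitAddCircle),
      (monomialFun β fun i => z i * unitPoint (θ i) / R) =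
      torusChar β θ * monomialFun β fun i => z i / R := fun β θ => by
    rw [torusChar, ← monomialFun_mul]
    congr 1
    ext i
    ring
  obtain ⟨C, hC⟩ : ∃ C, ∀ β, ‖torusCoeff g (fun _ => (R : ℂ)) β‖ ≤ C := by
    have hgc := hg.continuous
    have hc : Continuous fun θ : Fin n → UnitAddCircle => g fun i => R * unitPoint (θ i) := by
      fun_prop
    obtain ⟨C, hC⟩ := isCompact_univ.exists_bound_of_continuousOn hc.continuousOn
    refine ⟨C, fun β => ?_⟩
    have := norm_integral_le_of_norm_le_const (μ := torusMeasure n) (C := C)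
      (f := fun θ => (starRingEnd ℂ) (torusChar β θ) * g (fun i => R * unitPoint (θ i)))
      (.of_forall fun θ => by
        rw [norm_mul, RCLike.norm_conj, norm_torusChar, one_mul]; exact hC θ (mem_univ _))
    simpa [torusCoeff] using this
  have h := hasSum_integral_torus (n := n)
    (f := fun (β : Fin n → ℕ) θ => (torusCoeff g (fun _ => R) β * monomialFun β fun i => z i / R) *
      ((starRingEnd ℂ) (torusChar α θ) * torusChar β θ))
    (u := fun β => C * ‖monomialFun β fun i => z i / R‖)
    (s := fun θ => (starRingEnd ℂ) (torusChar α θ) * g (fun i => z i * unitPoint (θ i))) ?_ ?_ ?_ ?_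
  · simp only [integral_const_mul, integral_conj_torusChar_mul] at h
    refine h.unique ?_
    simpa using hasSum_single α (f := fun β => (torusCoeff g (fun _ => R) β *
      monomialFun β fun i => z i / R) * if β = α then 1 else 0) fun β hβ => by simp [hβ]
  · intro β
    exact continuous_const.mul
      ((Complex.continuous_conj.comp (continuous_torusChar α)).mul (continuous_torusChar β))
  · exact (summable_norm_monomialFun_div hz).mul_left C
  · intro β θ
    rw [norm_mul, norm_mul, norm_mul, RCLike.norm_conj, norm_torusChar, norm_torusChar, one_mul,
      mul_one]
    exact mul_le_mul_of_nonneg_right (hC β) (norm_nonneg _)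
  · intro θ
    refine ((hasSum_torusCoeff_mul hg (hz' θ)).mul_left _).congr_fun fun β => ?_
    rw [hmon]
    ring

end Expansion

section Taylor

variable {n : ℕ} {g : (Fin n → ℂ) → ℂ}

theorem exists_norm_lt (z : Fin n → ℂ) : ∃ R : ℝ, 1 < R ∧ ∀ i, ‖z i‖ < R :=
  ⟨‖z‖ + 2, by linarith [norm_nonneg z], fun i => by linarith [norm_le_pi_norm z i]⟩

/-- Both `z` and the point `1` are compared with one larger torus, which is why its radius must
exceed 1. -/
theorem torusCoeff_eq_mul_monomialFun (hg : Differentiable ℂ g) (z : Fin n → ℂ) (α : Fin n → ℕ) :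
    torusCoeff g z α = torusCoeff g 1 α * monomialFun α z := by
  obtain ⟨R, hR, hz⟩ := exists_norm_lt z
  rw [torusCoeff_eq hg hz, torusCoeff_eq hg (z := 1) (R := R) (fun _ => by simpa using hR), mul_assoc,
    ← monomialFun_mul]
  simp [div_eq_inv_mul]

/-- An entire function is the sum of its Taylor series on all of `ℂⁿ`. -/
theorem hasSum_torusCoeff (hg : Differentiable ℂ g) (z : Fin n → ℂ) :
    HasSum (fun α => torusCoeff g 1 α * monomialFun α z) (g z) := by
  obtain ⟨R, -, hz⟩ := exists_norm_lt z
  refine (hasSum_torusCoeff_mul hg hz).congr_fun fun α => ?_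
  rw [← torusCoeff_eq_mul_monomialFun hg, torusCoeff_eq hg hz]

end Taylor

end KoopmanPF

/-! ### Koopman modes as Taylor coefficients -/

namespace KoopmanPF

section SegalBargmann

variable {n : ℕ} {g : (Fin n → ℂ) → ℂ}

theorem integral_norm_pow_mul_exp_ne_zero (a : ℕ) :
    ∫ z : ℂ, (‖z‖ ^ a) ^ 2 * Real.exp (-‖z‖ ^ 2) ≠ 0 := by
  have h := Complex.integral_rpow_mul_exp_neg_rpow (p := 2) (q := 2 * a) one_le_two
    (by linarith [(Nat.cast_nonneg a : (0 : ℝ) ≤ a)])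
  have h2 : ∀ z : ℂ, (‖z‖ ^ a) ^ 2 * Real.exp (-‖z‖ ^ 2) =
      ‖z‖ ^ (2 * a : ℝ) * Real.exp (-‖z‖ ^ (2 : ℝ)) := fun z => by
    rw [Real.rpow_two, ← pow_mul, mul_comm a 2, ← Real.rpow_natCast]
    push_cast
    rfl
  simp only [h2, h]
  have := Real.Gamma_pos_of_pos (s := (2 * a + 2) / 2) (by positivity)
  positivity

theorem norm_monomialFun_sq_mul_gaussWeight (α : Fin n → ℕ) (z : Fin n → ℂ) :
    ‖monomialFun α z‖ ^ 2 * gaussWeight z =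
      ∏ i, (‖z i‖ ^ α i) ^ 2 * Real.exp (-‖z i‖ ^ 2) := by
  rw [norm_monomialFun, gaussWeight, ← Finset.sum_neg_distrib, Real.exp_sum,
    Finset.prod_mul_distrib, Finset.prod_pow]

theorem integrable_norm_monomialFun_sq (α : Fin n → ℕ) :
    Integrable fun z => ‖monomialFun α z‖ ^ 2 * gaussWeight z := by
  simp only [norm_monomialFun_sq_mul_gaussWeight]
  exact Integrable.fintype_prod (f := fun i (z : ℂ) => (‖z‖ ^ α i) ^ 2 * Real.exp (-‖z‖ ^ 2))
    -- A non-integrable function has integral 0 by convention, so a nonzero integral proves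
    -- integrability.
    fun i => not_imp_comm.1 integral_undef (integral_norm_pow_mul_exp_ne_zero (α i))

theorem segalBargmannInner_monomialFun_self_ne_zero (α : Fin n → ℕ) :
    segalBargmannInner (monomialFun α) (monomialFun α) ≠ 0 := by
  have h : ∀ z : Fin n → ℂ, monomialFun α z * (starRingEnd ℂ) (monomialFun α z) *
      (gaussWeight z : ℂ) = ((‖monomialFun α z‖ ^ 2 * gaussWeight z : ℝ) : ℂ) := fun z => by
    rw [Complex.mul_conj, Complex.normSq_eq_norm_sq]
    push_cast
    rfl
  rw [segalBargmannInner]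
  simp only [h, norm_monomialFun_sq_mul_gaussWeight]
  rw [integral_complex_ofReal,
    integral_fintype_prod_volume_eq_prod (fun i (z : ℂ) => (‖z‖ ^ α i) ^ 2 * Real.exp (-‖z‖ ^ 2))]
  refine mul_ne_zero (inv_ne_zero (pow_ne_zero _ (by exact_mod_cast Real.pi_ne_zero))) ?_
  exact_mod_cast Finset.prod_ne_zero_iff.2 fun i _ => integral_norm_pow_mul_exp_ne_zero (α i)

@[fun_prop] theorem continuous_gaussWeight : Continuous (gaussWeight (n := n)) := by
  unfold gaussWeight
  fun_prop

theorem gaussWeight_pos (z : Fin n → ℂ) : 0 < gaussWeight z := Real.exp_pos _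

theorem MemSegalBargmann.integrable_mul_conj_monomialFun (hg : MemSegalBargmann g)
    (α : Fin n → ℕ) :
    Integrable fun z => g z * (starRingEnd ℂ) (monomialFun α z) * (gaussWeight z : ℂ) := by
  have hc := hg.entire.continuous
  refine (hg.finiteNorm.add (integrable_norm_monomialFun_sq α)).mono'
    (Continuous.aestronglyMeasurable ?_) (.of_forall fun z => ?_)
  · exact (hc.mul (Complex.continuous_conj.comp (continuous_monomialFun α))).mul
      (Complex.continuous_ofReal.comp continuous_gaussWeight)
  · rw [norm_mul, norm_mul, RCLike.norm_conj, Complex.norm_real,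
      Real.norm_of_nonneg (gaussWeight_pos z).le, Pi.add_apply, ← add_mul]
    refine mul_le_mul_of_nonneg_right ?_ (gaussWeight_pos z).le
    nlinarith [sq_nonneg (‖g z‖ - ‖monomialFun α z‖), sq_nonneg ‖g z‖,
      sq_nonneg ‖monomialFun α z‖]

/-- Rotation of each coordinate of `ℂⁿ` preserves Lebesgue measure. -/
theorem measurePreserving_mul_unitPoint (θ : Fin n → UnitAddCircle) :
    MeasurePreserving fun (z : Fin n → ℂ) i => z i * unitPoint (θ i) := by
  refine volume_preserving_pi (f := fun i (w : ℂ) => w * unitPoint (θ i)) fun i => ?_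
  have h : (fun w : ℂ => w * unitPoint (θ i)) = rotation (AddCircle.toCircle (θ i)) :=
    funext fun w => by rw [rotation_apply, unitPoint, mul_comm]
  rw [h]
  exact (rotation (AddCircle.toCircle (θ i))).measurePreserving

theorem gaussWeight_mul_unitPoint (z : Fin n → ℂ) (θ : Fin n → UnitAddCircle) :
    gaussWeight (fun i => z i * unitPoint (θ i)) = gaussWeight z := by
  simp [gaussWeight]

/-- The integral is unchanged when `z` is rotated by any `θ`. Averaging over `θ` and exchanging the
integrals turns `g` into its Fourier coefficient. -/
theorem MemSegalBargmann.integral_mul_conj_monomialFun (hg : MemSegalBargmann g)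
    (α : Fin n → ℕ) :
    ∫ z, g z * (starRingEnd ℂ) (monomialFun α z) * (gaussWeight z : ℂ) =
      ∫ z, torusCoeff g z α * (starRingEnd ℂ) (monomialFun α z) * (gaussWeight z : ℂ) := by
  set h : (Fin n → ℂ) → ℂ := fun z => g z * (starRingEnd ℂ) (monomialFun α z) *
    (gaussWeight z : ℂ) with hh
  have hi : Integrable h := hg.integrable_mul_conj_monomialFun α
  have hgc := hg.entire.continuous
  have hc : Continuous h :=
    (hgc.mul (Complex.continuous_conj.comp (continuous_monomialFun α))).mul
      (Complex.continuous_ofReal.comp continuous_gaussWeight)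
  have hrot : ∀ θ : Fin n → UnitAddCircle, Measurable fun (z : Fin n → ℂ) i =>
      z i * unitPoint (θ i) := fun θ => (measurePreserving_mul_unitPoint θ).measurable
  have hint : ∀ (θ : Fin n → UnitAddCircle) {E : Type} [NormedAddCommGroup E] [NormedSpace ℝ E]
      {f : (Fin n → ℂ) → E}, Continuous f →
      ∫ z : Fin n → ℂ, f (fun i => z i * unitPoint (θ i)) = ∫ z, f z :=
    fun θ E _ _ f hf => by
      conv_rhs => rw [← (measurePreserving_mul_unitPoint θ).map_eq]
      rw [integral_map (hrot θ).aemeasurable hf.aestronglyMeasurable]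
  -- The norm of every rotated slice has the same integral, a constant on a probability space.
  have hprod : Integrable (fun p : (Fin n → UnitAddCircle) × (Fin n → ℂ) =>
      h fun i => p.2 i * unitPoint (p.1 i)) ((torusMeasure n).prod volume) := by
    refine (integrable_prod_iff (Continuous.aestronglyMeasurable (by fun_prop))).2
      ⟨.of_forall fun θ => ?_, ?_⟩
    · exact ((measurePreserving_mul_unitPoint θ).integrable_comp hc.aestronglyMeasurable).2 hi
    · simp only [hint _ hc.norm]
      exact integrable_const _
  calc ∫ z, h z = ∫ θ, (∫ z : Fin n → ℂ, h (fun i => z i * unitPoint (θ i))) ∂torusMeasure n := by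
        simp [hint _ hc]
    _ = ∫ z : Fin n → ℂ, (∫ θ, h (fun i => z i * unitPoint (θ i)) ∂torusMeasure n) :=
        integral_integral_swap hprod
    _ = _ := by
        refine integral_congr_ae (.of_forall fun z => ?_)
        simp only [torusCoeff]
        rw [← integral_mul_const, ← integral_mul_const]
        refine integral_congr_ae (.of_forall fun θ => ?_)
        simp only [hh, gaussWeight_mul_unitPoint, monomialFun_mul, map_mul, torusChar]
        ring

/-- After averaging, the numerator is the Taylor coefficient times the denominator, so no series has
to be exchanged with the Gaussian integral. -/
theorem koopmanMode_eq_torusCoeff {g : Fin n → (Fin n → ℂ) → ℂ} {k : Fin n}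
    (hg : MemSegalBargmann (g k)) (α : Fin n → ℕ) :
    koopmanMode g α k = torusCoeff (g k) 1 α := by
  rw [koopmanMode, div_eq_iff (segalBargmannInner_monomialFun_self_ne_zero α),
    segalBargmannInner, segalBargmannInner, hg.integral_mul_conj_monomialFun, mul_left_comm]
  have h : ∀ z, torusCoeff (g k) z α * (starRingEnd ℂ) (monomialFun α z) * (gaussWeight z : ℂ) =
      torusCoeff (g k) 1 α *
        (monomialFun α z * (starRingEnd ℂ) (monomialFun α z) * (gaussWeight z : ℂ)) := fun z => by
    rw [torusCoeff_eq_mul_monomialFun hg.entire z]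
    ring
  simp only [h, integral_const_mul]

end SegalBargmann

/-! ### Termwise differentiation and quadratic remainders -/

theorem hasDerivAt_comp_add_smul {n : ℕ} {f : (Fin n → ℂ) → ℂ} (hf : Differentiable ℂ f)
    (w v : Fin n → ℂ) : HasDerivAt (fun s : ℂ => f (w + s • v)) (fderiv ℂ f w v) 0 := by
  have h1 : HasDerivAt (fun s : ℂ => w + s • v) v 0 := by
    simpa using ((hasDerivAt_id (0 : ℂ)).smul_const v).const_add w
  have h2 : HasFDerivAt f (fderiv ℂ f w) (w + (0 : ℂ) • v) := by
    simpa using (hf w).hasFDerivAt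
  exact h2.comp_hasDerivAt 0 h1

theorem hasSum_torusCoeff_mul_fderiv {n : ℕ} {g : (Fin n → ℂ) → ℂ} (hg : Differentiable ℂ g)
    (w v : Fin n → ℂ) :
    HasSum (fun α => torusCoeff g 1 α * fderiv ℂ (monomialFun α) w v) (fderiv ℂ g w v) := by
  -- For `‖s‖ < 1` the `i`-th coordinate of `w + s • v` is at most `‖w i‖ + ‖v i‖`. The Taylor
  -- series converges absolutely at the point with these coordinates, which gives a uniform
  -- majorant.
  set u : (Fin n → ℕ) → ℝ := fun α =>
    ‖torusCoeff g 1 α * monomialFun α fun i => ((‖w i‖ + ‖v i‖ : ℝ) : ℂ)‖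
  have h := Complex.hasSum_deriv_of_summable_norm (u := u) (U := Metric.ball (0 : ℂ) 1) (z := 0)
    (F := fun (α : Fin n → ℕ) s => torusCoeff g 1 α * monomialFun α (w + s • v))
    (hasSum_torusCoeff hg _).summable.norm ?_ Metric.isOpen_ball ?_ (by simp)
  · have h3 : (fun s : ℂ => ∑' α, torusCoeff g 1 α * monomialFun α (w + s • v)) =
        fun s => g (w + s • v) := funext fun s => (hasSum_torusCoeff hg _).tsum_eq
    rw [h3, (hasDerivAt_comp_add_smul hg w v).deriv] at h
    refine h.congr_fun fun α => ?_
    rw [((hasDerivAt_comp_add_smul (differentiable_monomialFun α) w v).const_mul _).deriv]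
  · exact fun α => Differentiable.differentiableOn (by fun_prop)
  · intro α s hs
    simp only [u, norm_mul, norm_monomialFun]
    gcongr with i
    rw [Complex.norm_real, Real.norm_of_nonneg (by positivity)]
    refine (norm_add_le _ _).trans ?_
    rw [Pi.smul_apply, norm_smul]
    have : ‖s‖ ≤ 1 := by simpa using (mem_ball_zero_iff.1 hs).le
    gcongr
    exact mul_le_of_le_one_left (norm_nonneg _) this

/-- The sum of a series over all multi-indices, split by order. -/
theorem eq_add_sum_add_tsum_higherIndex {n : ℕ} {f : (Fin n → ℕ) → ℂ} {a : ℂ}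
    (hf : HasSum f a) :
    a = f 0 + ∑ j, f (Pi.single j 1) + ∑' α : HigherIndex n, f α := by
  classical
  have hinj : Function.Injective fun j : Fin n => (Pi.single j 1 : Fin n → ℕ) := fun i j h => by
    by_contra hij
    have := congrFun h i
    simp [hij] at this
  set s : Finset (Fin n → ℕ) := insert 0 (Finset.univ.image fun j => Pi.single j 1)
  have hmem : ∀ α : Fin n → ℕ, α ∉ s ↔ 1 < ∑ i, α i := fun α => by
    simp only [s, Finset.mem_insert, Finset.mem_image, Finset.mem_univ, true_and]
    rw [← not_le, not_iff_not]
    constructor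
    · rintro (rfl | ⟨j, rfl⟩) <;> simp
    · intro h
      by_cases h0 : α = 0
      · exact .inl h0
      · obtain ⟨j, hj⟩ := Function.ne_iff.1 h0
        refine .inr ⟨j, ?_⟩
        rw [← Finset.add_sum_erase _ _ (Finset.mem_univ j)] at h
        have hj : α j ≠ 0 := hj
        have h2 : ∑ i ∈ Finset.univ.erase j, α i = 0 := by omega
        ext i
        by_cases hij : i = j
        · subst hij; simp; omega
        · rw [Pi.single_eq_of_ne hij]
          exact (Finset.sum_eq_zero_iff.1 h2 i (by simp [hij])).symm
  rw [← hf.tsum_eq, ← hf.summable.sum_add_tsum_subtype_compl s]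
  congr 1
  · rw [Finset.sum_insert, Finset.sum_image hinj.injOn]
    simp only [Finset.mem_image, Finset.mem_univ, true_and, not_exists]
    intro j h
    have := congrFun h j
    simp at this
  · exact (Equiv.subtypeEquivRight hmem).tsum_eq fun α : HigherIndex n => f α

/-- First-order Taylor expansion with quadratic remainder. -/
theorem isBigO_sub_fderiv_of_contDiffAt {E F : Type*} [NormedAddCommGroup E] [NormedSpace ℝ E]
    [NormedAddCommGroup F] [NormedSpace ℝ F] {f : E → F} {x : E} (hf : ContDiffAt ℝ 2 f x) :
    (fun δ => f (x + δ) - f x - fderiv ℝ f x δ) =O[𝓝 0] fun δ => ‖δ‖ ^ 2 := by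
  obtain ⟨K, t, ht, hK⟩ := (hf.fderiv_right (m := 1) (by norm_num)).exists_lipschitzOnWith
  obtain ⟨r, hr, hball⟩ := Metric.mem_nhds_iff.1 (Filter.inter_mem ht
    ((hf.of_le one_le_two).eventually (by simp)))
  have hdiff : ∀ y ∈ Metric.ball x r, ContDiffAt ℝ 1 f y := fun y hy => (hball hy).2
  refine IsBigO.of_bound K ?_
  filter_upwards [Metric.ball_mem_nhds (0 : E) hr] with δ hδ
  have hδ : ‖δ‖ < r := by simpa using hδ
  have hsub : Metric.closedBall x ‖δ‖ ⊆ Metric.ball x r := Metric.closedBall_subset_ball hδ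
  have hx : x ∈ Metric.closedBall x ‖δ‖ := Metric.mem_closedBall_self (norm_nonneg _)
  -- On the ball of radius `‖δ‖` the derivative differs from its value at `x` by at most `K * ‖δ‖`;
  -- the mean value inequality supplies the second factor `‖δ‖`.
  have := Convex.norm_image_sub_le_of_norm_hasFDerivWithin_le' (f := f) (f' := fderiv ℝ f)
    (φ := fderiv ℝ f x) (s := Metric.closedBall x ‖δ‖) (C := K * ‖δ‖) (x := x) (y := x + δ)
    (fun y hy => ((hdiff y (hsub hy)).differentiableAt one_ne_zero).hasFDerivAt.hasFDerivWithinAt)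
    (fun y hy => ?_) (convex_closedBall _ _) hx (by simp)
  · simpa [pow_two, mul_assoc] using this
  · rw [← dist_eq_norm]
    refine (hK.dist_le_mul y (hball (hsub hy)).1 x (hball (hsub hx)).1).trans ?_
    gcongr
    exact hy

/-- Cauchy estimates on unit circles carry the bound `M` from `f` on radius 3 to `f'` on radius 2
and `f''` on radius 1. Two mean value inequalities then integrate back. -/
theorem norm_sub_sub_deriv_le {f : ℂ → ℂ} (hf : Differentiable ℂ f) {M : ℝ}
    (hM : ∀ s, ‖s‖ ≤ 3 → ‖f s‖ ≤ M) {s : ℂ} (hs : ‖s‖ ≤ 1) :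
    ‖f s - f 0 - s * deriv f 0‖ ≤ M * ‖s‖ ^ 2 := by
  have hnear : ∀ {s u : ℂ}, u ∈ Metric.sphere s 1 → ‖u‖ ≤ ‖s‖ + 1 := fun {s u} hu => by
    rw [mem_sphere_iff_norm] at hu
    linarith [norm_le_norm_add_norm_sub' u s]
  have h1 : ∀ s, ‖s‖ ≤ 2 → ‖deriv f s‖ ≤ M := fun s hs => by
    simpa using Complex.norm_deriv_le_of_forall_mem_sphere_norm_le one_pos hf.diffContOnCl
      fun u hu => hM u (by linarith [hnear hu])
  have hf' : Differentiable ℂ (deriv f) := hf.contDiff.differentiable_deriv_two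
  have h2 : ∀ s, ‖s‖ ≤ 1 → ‖deriv (deriv f) s‖ ≤ M := fun s hs => by
    simpa using Complex.norm_deriv_le_of_forall_mem_sphere_norm_le one_pos hf'.diffContOnCl
      fun u hu => h1 u (by linarith [hnear hu])
  have h3 : ∀ s, ‖s‖ ≤ 1 → ‖deriv f s - deriv f 0‖ ≤ M * ‖s‖ := fun s hs => by
    simpa using (convex_closedBall (0 : ℂ) 1).norm_image_sub_le_of_norm_deriv_le
      (fun u _ => hf' u) (fun u hu => h2 u (by simpa using hu)) (x := 0) (y := s)
      (by simp) (by simpa using hs)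
  have h4 : ∀ u, HasDerivAt (fun u => f u - u * deriv f 0) (deriv f u - deriv f 0) u := fun u => by
    simpa using (hf u).hasDerivAt.fun_sub ((hasDerivAt_id u).mul_const (deriv f 0))
  have hM0 : 0 ≤ M := (norm_nonneg _).trans (hM 0 (by simp))
  have h5 := (convex_closedBall (0 : ℂ) ‖s‖).norm_image_sub_le_of_norm_hasDerivWithin_le
    (fun u _ => (h4 u).hasDerivWithinAt) (C := M * ‖s‖) (x := 0) (y := s) (fun u hu => by
      have hu : ‖u‖ ≤ ‖s‖ := by simpa using hu
      exact (h3 u (hu.trans hs)).trans (by gcongr)) (by simp) (by simp)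
  calc ‖f s - f 0 - s * deriv f 0‖ = ‖f s - s * deriv f 0 - (f 0 - 0 * deriv f 0)‖ := by
        congr 1; ring
    _ ≤ M * ‖s‖ * ‖s - 0‖ := h5
    _ = M * ‖s‖ ^ 2 := by rw [sub_zero]; ring

/-- First-order Taylor expansion of an entire function with quadratic remainder. -/
theorem isBigO_sub_fderiv_of_entire {n : ℕ} {g : (Fin n → ℂ) → ℂ} (hg : Differentiable ℂ g)
    (w : Fin n → ℂ) :
    (fun h => g (w + h) - g w - fderiv ℂ g w h) =O[𝓝 0] fun h => ‖h‖ ^ 2 := by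
  obtain ⟨M, hM⟩ := (isCompact_closedBall w 3).exists_bound_of_continuousOn
    hg.continuous.continuousOn
  refine IsBigO.of_bound M ?_
  filter_upwards [Metric.ball_mem_nhds (0 : Fin n → ℂ) one_pos] with h hh
  have hh : ‖h‖ < 1 := by simpa using hh
  by_cases h0 : h = 0
  · simp [h0]
  have hn : (‖h‖ : ℂ) ≠ 0 := by simpa using h0
  -- On the complex line through `w` in the unit direction `v` the one-variable estimate applies,
  -- and `M` serves all directions.
  set v : Fin n → ℂ := (‖h‖ : ℂ)⁻¹ • h with hv
  have hv1 : ‖v‖ = 1 := by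
    rw [hv, norm_smul, norm_inv, Complex.norm_real, norm_norm, inv_mul_cancel₀ (by simpa using h0)]
  have hhv : h = (‖h‖ : ℂ) • v := by rw [hv, smul_inv_smul₀ hn]
  have hline : HasDerivAt (fun s : ℂ => g (w + s • v)) (fderiv ℂ g w v) 0 :=
    hasDerivAt_comp_add_smul hg w v
  have key := norm_sub_sub_deriv_le (f := fun s : ℂ => g (w + s • v)) (by fun_prop) (M := M)
    (fun s hs => hM _ (by simpa [norm_smul, hv1] using hs)) (s := (‖h‖ : ℂ)) (by simpa using hh.le)
  rw [hline.deriv, ← smul_eq_mul, ← map_smul, ← hhv] at key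
  simpa using key

/-- The error is the remainder of `g` at the increment of `f`, which is `O(‖δ‖)`, plus the
differential of `g` applied to the remainder of `f`. -/
theorem isBigO_comp_sub_fderiv {n : ℕ} {E : Type*} [NormedAddCommGroup E] [NormedSpace ℝ E]
    {g : (Fin n → ℂ) → ℂ} (hg : Differentiable ℂ g) {f : E → Fin n → ℂ} {x : E}
    (hf : ContDiffAt ℝ 2 f x) :
    (fun δ => (g ∘ f) (x + δ) - (g ∘ f) x - fderiv ℝ (g ∘ f) x δ) =O[𝓝 0] fun δ => ‖δ‖ ^ 2 := by
  have hd : DifferentiableAt ℝ f x := hf.differentiableAt two_ne_zero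
  have hshift : Tendsto (fun δ => x + δ) (𝓝 0) (𝓝 x) := by
    simpa using (continuous_const_add x).tendsto 0
  have hO : (fun δ => f (x + δ) - f x) =O[𝓝 0] fun δ => δ := by
    simpa [Function.comp_def] using hd.isBigO_sub.comp_tendsto hshift
  have h0 : Tendsto (fun δ => f (x + δ) - f x) (𝓝 0) (𝓝 0) := hO.trans_tendsto tendsto_id
  have h1 := ((isBigO_sub_fderiv_of_entire hg (f x)).comp_tendsto h0).trans (hO.norm_norm.pow 2)
  have h2 := ((fderiv ℂ g (f x)).isBigO_comp (fun δ => f (x + δ) - f x - fderiv ℝ f x δ)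
    (𝓝 0)).trans (isBigO_sub_fderiv_of_contDiffAt hf)
  refine (h1.add h2).congr_left fun δ => ?_
  rw [(((hg (f x)).hasFDerivAt.restrictScalars ℝ).comp x hd.hasFDerivAt).fderiv]
  simp only [Function.comp_apply, add_sub_cancel, map_sub, ContinuousLinearMap.comp_apply,
    ContinuousLinearMap.coe_restrictScalars']
  ring

end KoopmanPF

/-! ### The two expansions as differentials -/

namespace KoopmanPF

variable {n : ℕ} {F : State n → State n} {S : ℝ → State n → State n} {xs : State n}
  {lam : Fin n → ℂ} {φ : Fin n → State n → ℂ} {g : Fin n → (Fin n → ℂ) → ℂ} {x₀ : State n}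

theorem exp_eigenvalueComb_mul (lam : Fin n → ℂ) (α : Fin n → ℕ) (t : ℝ) :
    Complex.exp (eigenvalueComb lam α * t) = monomialFun α fun i => Complex.exp (lam i * t) := by
  simp only [eigenvalueComb, monomialFun, ← Complex.exp_nat_mul, ← Complex.exp_sum,
    Finset.sum_mul, mul_assoc]

theorem eigenMonomial_zero (φ : Fin n → State n → ℂ) : eigenMonomial φ 0 = fun _ => 1 := by
  ext x
  simp [eigenMonomial]

theorem eigenMonomial_single (φ : Fin n → State n → ℂ) (j : Fin n) :
    eigenMonomial φ (Pi.single j 1) = φ j := by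
  ext x
  rw [eigenMonomial, Finset.prod_eq_single j] <;> simp +contextual

theorem eigenvalueComb_single (lam : Fin n → ℂ) (j : Fin n) :
    eigenvalueComb lam (Pi.single j 1) = lam j := by
  rw [eigenvalueComb, Finset.sum_eq_single j] <;> simp +contextual

theorem sum_smul_partialDeriv {E : Type*} [NormedAddCommGroup E] [NormedSpace ℝ E]
    (f : State n → E) (x δ : State n) :
    ∑ l, δ l • partialDeriv l f x = fderiv ℝ f x δ := by
  have h := (EuclideanSpace.basisFun (Fin n) ℝ).sum_repr δ
  conv_rhs => rw [← h]
  simp [partialDeriv]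

/-- The eigenfunctions after time `t`: on the basin, this is `x ↦ φ (S t x)`. -/
def modalFlow (lam : Fin n → ℂ) (φ : Fin n → State n → ℂ) (t : ℝ) (x : State n) : Fin n → ℂ :=
  fun i => Complex.exp (lam i * t) * φ i x

theorem monomialFun_modalFlow (α : Fin n → ℕ) (t : ℝ) (x : State n) :
    monomialFun α (modalFlow lam φ t x) =
      Complex.exp (eigenvalueComb lam α * t) * eigenMonomial φ α x := by
  rw [exp_eigenvalueComb_mul]
  exact monomialFun_mul α _ fun i => φ i x

theorem contDiffAt_modalFlow (hφ : ∀ j, ContDiffAt ℝ ∞ (φ j) x₀) (t : ℝ) :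
    ContDiffAt ℝ ∞ (modalFlow lam φ t) x₀ :=
  contDiffAt_pi.2 fun i => contDiffAt_const.mul (hφ i)

theorem partialDeriv_comp_modalFlow {f : (Fin n → ℂ) → ℂ} (hf : Differentiable ℂ f)
    (hφ : ∀ j, ContDiffAt ℝ ∞ (φ j) x₀) (t : ℝ) (l : Fin n) :
    partialDeriv l (f ∘ modalFlow lam φ t) x₀ =
      fderiv ℂ f (modalFlow lam φ t x₀) (partialDeriv l (modalFlow lam φ t) x₀) := by
  have h1 := ((contDiffAt_modalFlow (lam := lam) hφ t).differentiableAt (by simp)).hasFDerivAt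
  have h2 := ((hf (modalFlow lam φ t x₀)).hasFDerivAt.restrictScalars ℝ).comp x₀ h1
  rw [partialDeriv, h2.fderiv]
  rfl

/-- The exponential times `φ^α` is `z^α` composed with `modalFlow`, so the chain rule identifies
each term of the expansion with a term of the differentiated Taylor series. -/
theorem exp_mul_partialDeriv_eigenMonomial (hφ : ∀ j, ContDiffAt ℝ ∞ (φ j) x₀) (t : ℝ)
    (l : Fin n) (α : Fin n → ℕ) :
    Complex.exp (eigenvalueComb lam α * t) * partialDeriv l (eigenMonomial φ α) x₀ =
      fderiv ℂ (monomialFun α) (modalFlow lam φ t x₀)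
        (partialDeriv l (modalFlow lam φ t) x₀) := by
  rw [← partialDeriv_comp_modalFlow (differentiable_monomialFun α) hφ]
  have h : monomialFun α ∘ modalFlow lam φ t =
      fun x => Complex.exp (eigenvalueComb lam α * t) * eigenMonomial φ α x :=
    funext fun x => monomialFun_modalFlow α t x
  have hd : DifferentiableAt ℝ (eigenMonomial φ α) x₀ := by
    have : ∀ i, DifferentiableAt ℝ (φ i) x₀ := fun i => (hφ i).differentiableAt (by simp)
    unfold eigenMonomial
    fun_prop
  rw [h, partialDeriv, partialDeriv, fderiv_const_mul hd]
  rfl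

theorem hasSum_exp_mul_gpModeInStateHigh {k : Fin n} (hg : MemSegalBargmann (g k))
    (hφ : ∀ j, ContDiffAt ℝ ∞ (φ j) x₀) (t : ℝ) (l : Fin n) :
    HasSum (fun α => Complex.exp (eigenvalueComb lam α * t) * gpModeInStateHigh φ g α k l x₀)
      (partialDeriv l (g k ∘ modalFlow lam φ t) x₀) := by
  rw [partialDeriv_comp_modalFlow hg.entire hφ]
  refine (hasSum_torusCoeff_mul_fderiv hg.entire _ _).congr_fun fun α => ?_
  rw [gpModeInStateHigh, ← mul_assoc, exp_mul_partialDeriv_eigenMonomial hφ,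
    koopmanMode_eq_torusCoeff hg, mul_comm]

theorem partialDeriv_comp_modalFlow_eq_sum {k : Fin n} (hg : MemSegalBargmann (g k))
    (hφ : ∀ j, ContDiffAt ℝ ∞ (φ j) x₀) (t : ℝ) (l : Fin n) :
    partialDeriv l (g k ∘ modalFlow lam φ t) x₀ =
      ∑ j, Complex.exp (lam j * t) * gpModeInState φ g j k l x₀ +
        ∑' α : HigherIndex n,
          Complex.exp (eigenvalueComb lam α * t) * gpModeInStateHigh φ g α k l x₀ := by
  rw [eq_add_sum_add_tsum_higherIndex (hasSum_exp_mul_gpModeInStateHigh hg hφ t l)]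
  -- The order-zero eigenfunction is constant, so it contributes nothing.
  have h0 : gpModeInStateHigh φ g 0 k l x₀ = 0 := by
    simp [gpModeInStateHigh, eigenMonomial_zero, partialDeriv]
  simp only [h0, mul_zero, zero_add, eigenvalueComb_single]
  simp only [gpModeInStateHigh, gpModeInState, eigenMonomial_single, principalMode]

theorem stateExpansion_eq_fderiv {k : Fin n} (hg : MemSegalBargmann (g k))
    (hφ : ∀ j, ContDiffAt ℝ ∞ (φ j) x₀) (t : ℝ) (δ : State n) :
    stateExpansion lam φ g k t x₀ δ = fderiv ℝ (g k ∘ modalFlow lam φ t) x₀ δ := by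
  have key : ∀ l, ∑ j, Complex.exp (lam j * t) * gpModeInState φ g j k l x₀ * (δ l : ℂ) +
      ∑' α : HigherIndex n, Complex.exp (eigenvalueComb lam α * t) *
        gpModeInStateHigh φ g α k l x₀ * (δ l : ℂ) =
      δ l • partialDeriv l (g k ∘ modalFlow lam φ t) x₀ := fun l => by
    rw [partialDeriv_comp_modalFlow_eq_sum hg hφ, ← Finset.sum_mul, tsum_mul_right, ← add_mul,
      Complex.real_smul, mul_comm]
  have hcomm : ∀ a b c d : ℂ, a + b + c + d = a + c + (b + d) := fun a b c d => by ring
  rw [← sum_smul_partialDeriv, ← Finset.add_sum_erase _ _ (Finset.mem_univ k), stateExpansion,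
    hcomm, ← Finset.sum_add_distrib]
  -- The participation factors are definitionally the case `l = k` of the generalized
  -- participations.
  exact congrArg₂ _ (key k) (Finset.sum_congr rfl fun l _ => key l)

theorem IsModulatedRep.hasSum_koopmanMode {B : Set (State n)} {k : Fin n} {f : State n → ℂ}
    (hg : IsModulatedRep B φ f (g k)) {x : State n} (hx : x ∈ B) :
    HasSum (fun α => koopmanMode g α k * eigenMonomial φ α x) (f x) := by
  rw [hg.eq_comp x hx]
  refine (hasSum_torusCoeff hg.mem.entire _).congr_fun fun α => ?_
  rw [koopmanMode_eq_torusCoeff hg.mem]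
  rfl

section Modal

variable {B : Set (State n)}
  (hg : ∀ k, IsModulatedRep B φ (fun x => ((x k : ℝ) : ℂ)) (g k)) (hx₀ : x₀ ∈ B)
  {δ : State n} (hδ : x₀ + δ ∈ B)

include hg hx₀ hδ

/-- The difference of the mode expansions of `x_k` at two points of the basin, hence exact in `δ`.
-/
theorem hasSum_koopmanMode_mul_initialChangeHigh (k : Fin n) :
    HasSum (fun α => koopmanMode g α k * initialChangeHigh φ α x₀ δ) (δ k : ℂ) := by
  have h := ((hg k).hasSum_koopmanMode hδ).sub ((hg k).hasSum_koopmanMode hx₀)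
  simpa [initialChangeHigh, mul_sub] using h

theorem summable_gpStateInModeHigh_mul (j k : Fin n) :
    Summable fun α : HigherIndex n =>
      gpStateInModeHigh φ g α j k x₀ * initialChangeHigh φ α x₀ δ := by
  have h := (((hasSum_koopmanMode_mul_initialChangeHigh hg hx₀ hδ k).summable.mul_left
    (partialDeriv k (φ j) x₀)).subtype {α | 1 < ∑ i, α i})
  exact h.congr fun α => (mul_assoc _ _ _).symm

/-- Each `δ k` in `∑ k, δ k • ∂φ_j/∂x_k` is replaced by its expansion in the initial changes of the
modes. The equality is exact, without error term. -/
theorem modalExpansion_eq_fderiv (j : Fin n) (t : ℝ) :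
    modalExpansion lam φ g j t x₀ δ =
      Complex.exp (lam j * t) * fderiv ℝ (φ j) x₀ δ := by
  have hk : ∀ k, (δ k : ℂ) = ∑ i, principalMode g i k * initialChange φ i x₀ δ +
      ∑' α : HigherIndex n, koopmanMode g α k * initialChangeHigh φ α x₀ δ := fun k => by
    rw [eq_add_sum_add_tsum_higherIndex
      (hasSum_koopmanMode_mul_initialChangeHigh hg hx₀ hδ k)]
    simp [initialChangeHigh, initialChange, eigenMonomial_zero, eigenMonomial_single,
      principalMode]
  rw [← sum_smul_partialDeriv, modalExpansion, ← mul_add, ← mul_add,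
    Summable.tsum_finsetSum fun k _ => summable_gpStateInModeHigh_mul hg hx₀ hδ j k]
  congr 1
  have h1 : (∑ k, pf φ g j k x₀) * initialChange φ j x₀ δ =
      ∑ k, gpStateInMode φ g j j k x₀ * initialChange φ j x₀ δ := Finset.sum_mul _ _ _
  rw [h1, Finset.add_sum_erase _ (fun i => ∑ k, gpStateInMode φ g i j k x₀ *
    initialChange φ i x₀ δ) (Finset.mem_univ j), Finset.sum_comm, ← Finset.sum_add_distrib]
  refine Finset.sum_congr rfl fun k _ => ?_
  rw [Complex.real_smul, hk k, mul_comm, mul_add, Finset.mul_sum, ← tsum_mul_left]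
  simp only [gpStateInMode, gpStateInModeHigh, mul_assoc]

end Modal

end KoopmanPF

end

theorem mainTheorem1 (n : ℕ)
    (F : KoopmanPF.State n → KoopmanPF.State n) (hF : AnalyticOnNhd ℝ F Set.univ)
    (S : ℝ → KoopmanPF.State n → KoopmanPF.State n) (hS : KoopmanPF.IsSemiflow F S)
    (xs : KoopmanPF.State n) (hxs : KoopmanPF.IsStableEquilibrium F S xs)
    (lam : Fin n → ℂ) (hlam : KoopmanPF.HasSpectrum F xs lam)
    (φ : Fin n → KoopmanPF.State n → ℂ)
    (hφ : ∀ j, KoopmanPF.IsKoopmanEigenfunction S (KoopmanPF.basin S xs) (lam j) (φ j))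
    (g : Fin n → (Fin n → ℂ) → ℂ)
    (hg : ∀ k, KoopmanPF.IsModulatedRep (KoopmanPF.basin S xs) φ (fun x => ((x k : ℝ) : ℂ)) (g k))
    (x₀ : KoopmanPF.State n) (hx₀ : x₀ ∈ KoopmanPF.basin S xs) :
    -- small changes of the initial state stay in the basin
    (∀ᶠ δ in 𝓝 (0 : KoopmanPF.State n), x₀ + δ ∈ KoopmanPF.basin S xs) ∧
    -- the state variation: the series converge and the expansion holds to first order
    (∀ k : Fin n, ∀ t : ℝ, 0 ≤ t →
      (Summable fun α : KoopmanPF.HigherIndex n =>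
        Complex.exp (KoopmanPF.eigenvalueComb lam α * t) * KoopmanPF.pfHigh φ g α k x₀) ∧
      (∀ l : Fin n, l ≠ k → Summable fun α : KoopmanPF.HigherIndex n =>
        Complex.exp (KoopmanPF.eigenvalueComb lam α * t) *
          KoopmanPF.gpModeInStateHigh φ g α k l x₀) ∧
      (fun δ : KoopmanPF.State n =>
          ((KoopmanPF.stateVariation S k t x₀ δ : ℝ) : ℂ)
            - KoopmanPF.stateExpansion lam φ g k t x₀ δ)
        =O[𝓝 0] (fun δ : KoopmanPF.State n => ‖δ‖ ^ 2)) ∧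
    -- the modal variation: the series converge and the expansion holds to first order
    (∀ j : Fin n,
      (∀ δ : KoopmanPF.State n, x₀ + δ ∈ KoopmanPF.basin S xs → ∀ k : Fin n,
        Summable fun α : KoopmanPF.HigherIndex n =>
          KoopmanPF.gpStateInModeHigh φ g α j k x₀ * KoopmanPF.initialChangeHigh φ α x₀ δ) ∧
      (∀ t : ℝ, 0 ≤ t →
        (fun δ : KoopmanPF.State n =>
            KoopmanPF.modalVariation S φ j t x₀ δ - KoopmanPF.modalExpansion lam φ g j t x₀ δ)
          =O[𝓝 0] (fun δ : KoopmanPF.State n => ‖δ‖ ^ 2))) := by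
  have hF1 : ContDiff ℝ 1 F := contDiff_iff_contDiffAt.2 fun x => (hF x (mem_univ x)).contDiffAt
  have hopen := hS.isOpen_basin hF1 hxs
  have hφ₀ : ∀ j, ContDiffAt ℝ ∞ (φ j) x₀ := fun j =>
    (hφ j).smooth.contDiffAt (hopen.mem_nhds hx₀)
  have hev : ∀ᶠ δ in 𝓝 (0 : KoopmanPF.State n), x₀ + δ ∈ KoopmanPF.basin S xs := by
    have h : Tendsto (fun δ => x₀ + δ) (𝓝 (0 : KoopmanPF.State n)) (𝓝 x₀) := by
      simpa using (continuous_const_add x₀).tendsto 0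
    exact h.eventually (hopen.mem_nhds hx₀)
  refine ⟨hev, fun k t ht => ?_, fun j => ⟨fun δ hδ k => ?_, fun t ht => ?_⟩⟩
  · have hsum : ∀ l, Summable fun α : KoopmanPF.HigherIndex n =>
        Complex.exp (KoopmanPF.eigenvalueComb lam α * t) *
          KoopmanPF.gpModeInStateHigh φ g α k l x₀ := fun l =>
      (KoopmanPF.hasSum_exp_mul_gpModeInStateHigh (hg k).mem hφ₀ t l).summable.subtype _
    refine ⟨hsum k, fun l _ => hsum l, ?_⟩
    -- The basin is invariant under `S t`, so the representation by `g k` applies at `S t x`, where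
    -- the eigenfunctions take the values `modalFlow`.
    have hflow : ∀ x ∈ KoopmanPF.basin S xs,
        ((S t x k : ℝ) : ℂ) = (g k ∘ KoopmanPF.modalFlow lam φ t) x := fun x hx => by
      rw [(hg k).eq_comp _ ((hS.apply_mem_basin_iff hF1 ht).2 hx)]
      exact congrArg (g k) (funext fun i => (hφ i).eigen x hx t ht)
    refine (KoopmanPF.isBigO_comp_sub_fderiv (hg k).mem.entire
      ((KoopmanPF.contDiffAt_modalFlow (lam := lam) hφ₀ t).of_le
        (WithTop.coe_le_coe.2 (le_top : (2 : ℕ∞) ≤ ⊤)))).congr' ?_ .rfl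
    filter_upwards [hev] with δ hδ
    rw [KoopmanPF.stateExpansion_eq_fderiv (hg k).mem hφ₀, KoopmanPF.stateVariation]
    push_cast
    rw [hflow _ hδ, hflow _ hx₀]
  · exact KoopmanPF.summable_gpStateInModeHigh_mul hg hx₀ hδ j k
  · refine ((KoopmanPF.isBigO_sub_fderiv_of_contDiffAt
      ((hφ₀ j).of_le (WithTop.coe_le_coe.2 (le_top : (2 : ℕ∞) ≤ ⊤)))).const_mul_left
      (Complex.exp (lam j * t))).congr' ?_ .rfl
    filter_upwards [hev] with δ hδ
    rw [KoopmanPF.modalExpansion_eq_fderiv hg hx₀ hδ, KoopmanPF.modalVariation,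
      (hφ j).eigen _ hδ t ht, (hφ j).eigen _ hx₀ t ht]
    ring
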